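/- Let $\sigma$ denote the GroupSort function of group size 2 on $\mathbb{R}^k$, which for even $k$ is $\sigma(x_1,\dots,x_k)=(\max(x_1,x_2),\min(x_1,x_2),\dots,\max(x_{k-1},x_k),\min(x_{k-1},x_k))$. Let $d\ge 1$ and $d_x,d_y\ge 0$ be integers, let $\mathcal{X}\subset\mathbb{R}^{d_x}$ be such that $\lVert x\rVert\le B$ (Euclidean norm) for all $x\in\mathcal{X}$, and let $\mathcal{Y}\subset\mathbb{R}^{d_y}$. Fix matrix sizes $m_i\times n_i$ $(i=1,\dots,d)$ with $n_1=d_x$, $n_{i+1}=m_i$, $m_d=1$, and $m_i$ even for $1\le i\le d-1$. Let $\mathcal{H}^{SD}_d$ be the class of all functions $\mathcal{X}\to\mathbb{R}$ of the form $$x\mapsto W_d\,\sigma(W_{d-1}\,\sigma(\cdots\sigma(W_1x))),\qquad W_i\in\mathbb{R}^{m_i\times n_i},\ \lVert W_i\rVert_2=1\ \ (i=1,\dots,d),$$ where $\lVert\cdot\rVert_2$ is the spectral norm (SpectralDense LCNNs of depth $d$, without bias terms). Let $\mathcal{H}$ be the class of all functions $h:\mathcal{X}\to\mathcal{Y}$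 each of whose component functions $h_1,\dots,h_{d_y}$ belongs to $\mathcal{H}^{SD}_d$. Let $L:\mathcal{Y}\times\mathcal{Y}\to\mathbb{R}^{\ge 0}$ be a loss function that is bounded, $L(y,y')\le M$ for all $y,y'\in\mathcal{Y}$ and some $M>0$, and such that for every $y'\in\mathcal{Y}$ the function $y\mapsto L(y,y')$ is $L_r$-Lipschitz with respect to the Euclidean norm, where $L_r>0$. Put $\mathcal{G}=\{(x,y)\mapsto L(h(x),y) : h\in\mathcal{H}\}$. Then for every $m\ge 1$ and every sample $S=(s_1,\dots,s_m)$ of points of $\mathcal{X}\times\mathcal{Y}$, the empirical Rademacher complexity $\mathcal{R}_S(\mathcal{G})=\mathbb{E}_\epsilon\sup_{g\in\mathcal{G}}\frac1m\sum_{i=1}^m\epsilon_i g(s_i)$, with $\epsilon_1,\dots,\epsilon_m$ independent and uniform on $\{-1,1\}$ (and with the supremum over an empty class read as $0$), satisfies $$\mathcal{R}_S(\mathcal{G})\le\frac{\sqrt2\,d_y\,L_r\,B}{\sqrt m}\;2^{d-1}\prod_{i=1}^{d-1}\min(m_i,n_i).$$ -/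

import Mathlib

namespace LCNN

open scoped BigOperators Matrix

/-- The GroupSort activation of group size 2 on `ℝ^m`: the (zero-based) coordinates
`(0,1), (2,3), …` are paired and each pair `(a, b)` is replaced by `(max a b, min a b)`;
if `m` is odd, the last coordinate is left unchanged. -/
def groupSort {m : ℕ} (x : Fin m → ℝ) (i : Fin m) : ℝ :=
  if (i : ℕ) % 2 = 1 then
    min (x ⟨(i : ℕ) - 1, lt_of_le_of_lt (Nat.sub_le _ _) i.isLt⟩) (x i)
  else if h : (i : ℕ) + 1 < m then max (x i) (x ⟨(i : ℕ) + 1, h⟩)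
  else x i

open scoped Matrix.Norms.L2Operator in
/-- The spectral norm of a real matrix: its operator norm between Euclidean spaces, i.e. its
largest singular value. -/
noncomputable def matrixSpectralNorm {m n : ℕ} (A : Matrix (Fin m) (Fin n) ℝ) : ℝ := ‖A‖

/-- `hidden w W k x = σ (W_k σ (W_{k-1} ⋯ σ (W_1 x)))`, the output of the first `k` hidden
layers. The number `w i` is the width of layer `i` (with `w 0` the input dimension), and `W i`
is the weight matrix that is usually numbered `i + 1`; it has `w (i + 1)` rows and `w i`
columns. -/
def hidden (w : ℕ → ℕ) (W : (i : ℕ) → Matrix (Fin (w (i + 1))) (Fin (w i)) ℝ) :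
    (k : ℕ) → (Fin (w 0) → ℝ) → (Fin (w k) → ℝ)
  | 0, x => x
  | k + 1, x => groupSort (W k *ᵥ hidden w W k x)

/-- The class of real-valued SpectralDense LCNNs of depth `d ≥ 1` and layer widths
`w 0, …, w (d - 1)` on the input domain `X`: the functions
`x ↦ W_d σ (W_{d-1} σ (⋯ σ (W_1 x)))` all of whose weight matrices have spectral norm `1`.
The last matrix `W_d`, written `V`, has a single row. Only the entries
`W 0, …, W (d - 2)` of the family `W` are used. -/
def spectralDenseClass (d : ℕ) (w : ℕ → ℕ) (X : Set (EuclideanSpace ℝ (Fin (w 0)))) :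
    Set (X → ℝ) :=
  {f | ∃ (W : (i : ℕ) → Matrix (Fin (w (i + 1))) (Fin (w i)) ℝ)
      (V : Matrix (Fin 1) (Fin (w (d - 1))) ℝ),
      (∀ i < d - 1, matrixSpectralNorm (W i) = 1) ∧ matrixSpectralNorm V = 1 ∧
      ∀ x : X, f x = (V *ᵥ hidden w W (d - 1) (fun j => (x : EuclideanSpace ℝ (Fin (w 0))) j)) 0}

/-- The functions `h : X → Y ⊆ ℝ^{dy}` each of whose component functions is a real-valued
SpectralDense LCNN of depth `d` and layer widths `w`. -/
def vectorClass (d : ℕ) (w : ℕ → ℕ) {dy : ℕ} (X : Set (EuclideanSpace ℝ (Fin (w 0))))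
    (Y : Set (EuclideanSpace ℝ (Fin dy))) : Set (X → Y) :=
  {h | ∀ k : Fin dy,
    (fun x : X => (h x : EuclideanSpace ℝ (Fin dy)) k) ∈ spectralDenseClass d w X}

/-- The loss class `{(x, y) ↦ L (h x) y | h ∈ H}`. -/
def lossClass {X Y : Type*} (L : Y → Y → ℝ) (H : Set (X → Y)) : Set (X × Y → ℝ) :=
  {g | ∃ h ∈ H, g = fun s => L (h s.1) s.2}

/-- The empirical Rademacher complexity
`E_ε sup_{g ∈ G} (1/m) ∑ i, ε_i g (s_i)` of a class `G` on a sample `s_1, …, s_m`. The signs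
`ε_i` are independent and uniform on `{1, -1} = ℤˣ`, so the expectation is the average over all
`2^m` sign vectors. -/
noncomputable def empiricalRademacher {Z : Type*} {m : ℕ} (S : Fin m → Z) (G : Set (Z → ℝ)) : ℝ :=
  𝔼 ε : Fin m → ℤˣ,
    sSup ((fun g : Z → ℝ => (1 / (m : ℝ)) * ∑ i, ((ε i : ℤ) : ℝ) * g (S i)) '' G)

end LCNN

namespace LCNN

open scoped BigOperators Matrix

/-! ### Averages over sign vectors -/

/-! Suprema are replaced by selections: it suffices to bound the average for every choice of
function as a map of the signs. Signs are traded one at a time for symmetric noise dominating the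
increments of the loss (`exists_selection_contraction`). Khintchine's inequality with constant `√2`
(`sqrt_sum_sq_le_expect`) supplies such noise as a signed sum of the output coordinates, which
leaves `√2 * Lr` times `dy` scalar problems.

A scalar network is treated by induction on its layers, with `C` bounding the average of `∑ i, ε i *
⟪v, h i⟫` over the unit ball of `v`. GroupSort is a pair average plus half the absolute difference
in a pair. The average is linear and goes into `v`, at cost `C`. In the absolute values only the
worst normalized row difference matters; Cauchy–Schwarz and the Frobenius bound give it the factor
`√N`, where `N` is the smaller dimension of the layer, and contraction by `|·|` bounds the remaining
average by `2 * C` (`SelectionBound.layer`, `SelectionBound.abs`). Now `1 + 2√N ≤ 2N` for `N ≥ 2`.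
Evenness leaves `N = 1` only for one-dimensional inputs, where a direct estimate saves the factor 2.
-/

theorem neg_cons_sign {n : ℕ} (e : ℤˣ) (x : Fin n → ℤˣ) :
    -(Fin.cons e x : Fin (n + 1) → ℤˣ) = (Fin.cons (-e) (-x) : Fin (n + 1) → ℤˣ) := by
  funext i
  refine Fin.cases ?_ (fun j => ?_) i <;> simp

theorem expect_sign (f : ℤˣ → ℝ) : 𝔼 e, f e = (f 1 + f (-1)) / 2 := by
  rw [Fintype.expect_eq_sum_div_card]
  have h : (Finset.univ : Finset ℤˣ) = {1, -1} := by decide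
  rw [h, Finset.sum_pair (by decide)]
  simp

theorem expect_of_equiv_prod {ι α β : Type*} [Fintype ι] [Fintype α] [Fintype β]
    (e : ι ≃ α × β) (f : ι → ℝ) : 𝔼 x, f x = 𝔼 a, 𝔼 b, f (e.symm (a, b)) := by
  rw [Fintype.expect_equiv e f (fun p => f (e.symm p)) (fun i => by simp),
    ← Finset.univ_product_univ, Finset.expect_product]

theorem expect_cons {N : Type*} [Fintype N] {n : ℕ} (f : (Fin (n + 1) → N) → ℝ) :
    𝔼 x, f x = 𝔼 e, 𝔼 y, f (Fin.cons e y) :=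
  expect_of_equiv_prod (Fin.consEquiv (fun _ : Fin (n + 1) => N)).symm f

theorem expect_cons_sign {n : ℕ} (f : (Fin (n + 1) → ℤˣ) → ℝ) :
    𝔼 x, f x = 𝔼 y, (f (Fin.cons 1 y) + f (Fin.cons (-1) y)) / 2 := by
  rw [expect_cons, expect_sign, ← Finset.expect_add_distrib, Finset.expect_div]

theorem expect_neg {ι : Type*} [Fintype ι] [InvolutiveNeg ι] (f : ι → ℝ) :
    𝔼 x, f (-x) = 𝔼 x, f x :=
  Fintype.expect_equiv (Equiv.neg ι) _ _ (fun _ => rfl)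

theorem expect_mono {ι : Type*} [Fintype ι] {f g : ι → ℝ} (h : ∀ x, f x ≤ g x) :
    𝔼 x, f x ≤ 𝔼 x, g x :=
  Finset.expect_le_expect fun x _ => h x

theorem sq_expect_le {ι : Type*} [Fintype ι] [Nonempty ι] (f : ι → ℝ) :
    (𝔼 x, f x) ^ 2 ≤ 𝔼 x, f x ^ 2 := by
  have h := Finset.expect_mul_sq_le_sq_mul_sq Finset.univ f (fun _ => 1)
  simpa [Fintype.expect_const] using h

/-- Averaging over one sign is the parallelogram law; the offset `a` carries the remaining signs
through the induction. -/
theorem expect_sq_add_sum {E : Type*} [NormedAddCommGroup E] [InnerProductSpace ℝ E] (n : ℕ)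
    (a : E) (x : Fin n → E) :
    𝔼 ε : Fin n → ℤˣ, ‖a + ∑ i, ((ε i : ℤ) : ℝ) • x i‖ ^ 2 = ‖a‖ ^ 2 + ∑ i, ‖x i‖ ^ 2 := by
  induction n generalizing a with
  | zero => simp
  | succ n ih =>
    rw [expect_cons_sign, Fin.sum_univ_succ, ← add_assoc]
    have key : ∀ y : Fin n → ℤˣ,
        (‖a + ∑ i, (((Fin.cons 1 y : Fin (n + 1) → ℤˣ) i : ℤ) : ℝ) • x i‖ ^ 2 +
          ‖a + ∑ i, (((Fin.cons (-1) y : Fin (n + 1) → ℤˣ) i : ℤ) : ℝ) • x i‖ ^ 2) / 2 =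
        ‖a + ∑ i, ((y i : ℤ) : ℝ) • x i.succ‖ ^ 2 + ‖x 0‖ ^ 2 := by
      intro y
      have hp := parallelogram_law_with_norm ℝ (a + ∑ i, ((y i : ℤ) : ℝ) • x i.succ) (x 0)
      simp only [Fin.sum_univ_succ, Fin.cons_zero, Fin.cons_succ, Units.val_one, Units.val_neg,
        Int.cast_one, Int.cast_neg, one_smul, neg_smul]
      rw [show a + (x 0 + ∑ i : Fin n, ((y i : ℤ) : ℝ) • x i.succ) =
          a + ∑ i, ((y i : ℤ) : ℝ) • x i.succ + x 0 by abel,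
        show a + (-x 0 + ∑ i : Fin n, ((y i : ℤ) : ℝ) • x i.succ) =
          a + ∑ i, ((y i : ℤ) : ℝ) • x i.succ - x 0 by abel]
      linarith
    simp only [key]
    rw [Finset.expect_add_distrib, ih, Fintype.expect_const]
    ring

theorem expect_norm_sum_le {E : Type*} [NormedAddCommGroup E] [InnerProductSpace ℝ E] {n : ℕ}
    (x : Fin n → E) {B : ℝ} (hB : 0 ≤ B) (hx : ∀ i, ‖x i‖ ≤ B) :
    𝔼 ε : Fin n → ℤˣ, ‖∑ i, ((ε i : ℤ) : ℝ) • x i‖ ≤ B * √n := by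
  have h1 := sq_expect_le (fun ε : Fin n → ℤˣ => ‖∑ i, ((ε i : ℤ) : ℝ) • x i‖)
  have h2 := expect_sq_add_sum n 0 x
  simp only [zero_add, norm_zero] at h2
  rw [h2] at h1
  have h3 : ∑ i, ‖x i‖ ^ 2 ≤ n * B ^ 2 := by
    calc ∑ i, ‖x i‖ ^ 2 ≤ ∑ _i : Fin n, B ^ 2 :=
          Finset.sum_le_sum fun i _ => pow_le_pow_left₀ (norm_nonneg _) (hx i) 2
      _ = n * B ^ 2 := by simp
  refine le_of_sq_le_sq ?_ (by positivity)
  rw [mul_pow, Real.sq_sqrt (Nat.cast_nonneg n)]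
  nlinarith

/-! ### Khintchine's inequality with the constant `√2` -/

/-- The Dirichlet form of a function on the discrete cube. -/
noncomputable def cubeEnergy {n : ℕ} (f : (Fin n → ℤˣ) → ℝ) : ℝ :=
  𝔼 x, f x * ∑ i, (f x - f (Function.update x i (-x i))) / 2

/-- The average of `f` over its first coordinate. -/
noncomputable def headAvg {n : ℕ} (f : (Fin (n + 1) → ℤˣ) → ℝ) (y : Fin n → ℤˣ) : ℝ :=
  (f (Fin.cons 1 y) + f (Fin.cons (-1) y)) / 2

/-- Half of the difference of `f` in its first coordinate. -/
noncomputable def headDiff {n : ℕ} (f : (Fin (n + 1) → ℤˣ) → ℝ) (y : Fin n → ℤˣ) : ℝ :=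
  (f (Fin.cons 1 y) - f (Fin.cons (-1) y)) / 2

/-- With `f = headAvg f + x₀ * headDiff f`, the cross terms cancel on averaging over `x₀`, and
flipping `x₀` itself contributes the square of `headDiff f`. -/
theorem cubeEnergy_succ {n : ℕ} (f : (Fin (n + 1) → ℤˣ) → ℝ) :
    cubeEnergy f =
      cubeEnergy (headAvg f) + cubeEnergy (headDiff f) + 𝔼 y, headDiff f y ^ 2 := by
  unfold cubeEnergy
  rw [expect_cons_sign, ← Finset.expect_add_distrib, ← Finset.expect_add_distrib]
  refine Finset.expect_congr rfl fun y _ => ?_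
  simp only [Fin.sum_univ_succ, Fin.cons_zero, Fin.cons_succ, Fin.update_cons_zero,
    ← Fin.cons_update, neg_neg]
  have h : ∀ g : (Fin n → ℤˣ) → ℝ, ∑ i, (g y - g (Function.update y i (-y i))) / 2 =
      (n * g y - ∑ i, g (Function.update y i (-y i))) / 2 := by
    intro g
    rw [← Finset.sum_div, Finset.sum_sub_distrib]
    simp
  rw [h (headAvg f), h (headDiff f), h (fun z => f (Fin.cons 1 z)),
    h (fun z => f (Fin.cons (-1) z))]
  simp only [headAvg, headDiff, ← Finset.sum_div, Finset.sum_add_distrib, Finset.sum_sub_distrib]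
  ring

theorem expect_sq_succ {n : ℕ} (f : (Fin (n + 1) → ℤˣ) → ℝ) :
    𝔼 x, f x ^ 2 = (𝔼 y, headAvg f y ^ 2) + 𝔼 y, headDiff f y ^ 2 := by
  rw [expect_cons_sign, ← Finset.expect_add_distrib]
  refine Finset.expect_congr rfl fun y _ => ?_
  unfold headAvg headDiff
  ring

theorem apply_cons_neg {n : ℕ} (f : (Fin (n + 1) → ℤˣ) → ℝ) (e : ℤˣ) (y : Fin n → ℤˣ) :
    f (Fin.cons e (-y)) = f (-(Fin.cons (-e) y : Fin (n + 1) → ℤˣ)) := by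
  rw [neg_cons_sign, neg_neg]

/-- Spectral gap: odd functions have only Walsh levels `≥ 1`, even functions only level 0 and levels
`≥ 2`. The two claims are proved jointly because `headDiff` reverses parity. -/
theorem expect_sq_le_cubeEnergy {n : ℕ} (f : (Fin n → ℤˣ) → ℝ) :
    ((∀ x, f (-x) = -f x) → 𝔼 x, f x ^ 2 ≤ cubeEnergy f) ∧
      ((∀ x, f (-x) = f x) → 2 * (𝔼 x, f x ^ 2 - (𝔼 x, f x) ^ 2) ≤ cubeEnergy f) := by
  induction n with
  | zero =>
    have hE : cubeEnergy f = 0 := by simp [cubeEnergy]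
    refine ⟨fun h => ?_, fun h => ?_⟩
    · have h0 : ∀ x, f x = 0 := fun x => by
        have := h x
        rw [Subsingleton.elim (-x) x] at this
        linarith
      simp [hE, h0]
    · have h0 : ∀ x, f x = f 1 := fun x => by rw [Subsingleton.elim x 1]
      simp [hE, h0]
  | succ n ih =>
    have hD : 0 ≤ 𝔼 y, headDiff f y ^ 2 := Finset.expect_nonneg fun y _ => sq_nonneg _
    refine ⟨fun h => ?_, fun h => ?_⟩
    · have ha : ∀ y, headAvg f (-y) = -headAvg f y := fun y => by
        unfold headAvg
        rw [apply_cons_neg f, apply_cons_neg f, h, h, neg_neg]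
        ring
      have hb : ∀ y, headDiff f (-y) = headDiff f y := fun y => by
        unfold headDiff
        rw [apply_cons_neg f, apply_cons_neg f, h, h, neg_neg]
        ring
      have h1 := (ih (headAvg f)).1 ha
      have h2 := (ih (headDiff f)).2 hb
      have h3 := sq_expect_le (headDiff f)
      rw [cubeEnergy_succ, expect_sq_succ]
      linarith
    · have ha : ∀ y, headAvg f (-y) = headAvg f y := fun y => by
        unfold headAvg
        rw [apply_cons_neg f, apply_cons_neg f, h, h, neg_neg]
        ring
      have hb : ∀ y, headDiff f (-y) = -headDiff f y := fun y => by
        unfold headDiff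
        rw [apply_cons_neg f, apply_cons_neg f, h, h, neg_neg]
        ring
      have h1 := (ih (headAvg f)).2 ha
      have h2 := (ih (headDiff f)).1 hb
      have h3 : 𝔼 x, f x = 𝔼 y, headAvg f y := expect_cons_sign f
      rw [cubeEnergy_succ, expect_sq_succ, h3]
      linarith

/-- The bound is pointwise: the flipped sums `s - 2 x_i a_i` add up to `(n - 2) s`, so the triangle
inequality controls the sum of their absolute values from below. -/
theorem cubeEnergy_abs_sum_le {n : ℕ} (a : Fin n → ℝ) :
    cubeEnergy (fun x => |∑ i, ((x i : ℤ) : ℝ) * a i|) ≤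
      𝔼 x : Fin n → ℤˣ, |∑ i, ((x i : ℤ) : ℝ) * a i| ^ 2 := by
  refine expect_mono fun x => ?_
  set s := ∑ i, ((x i : ℤ) : ℝ) * a i with hs
  have hflip : ∀ i, ∑ j, ((Function.update x i (-x i) j : ℤ) : ℝ) * a j =
      s - 2 * (((x i : ℤ) : ℝ) * a i) := by
    intro i
    rw [hs, ← Finset.add_sum_erase _ _ (Finset.mem_univ i),
      ← Finset.add_sum_erase Finset.univ (fun j => ((x j : ℤ) : ℝ) * a j) (Finset.mem_univ i),
      Finset.sum_congr rfl (g := fun j => ((x j : ℤ) : ℝ) * a j) (fun j hj => by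
        rw [Function.update_of_ne (Finset.ne_of_mem_erase hj)])]
    simp
    ring
  have hsum : (n - 2) * |s| ≤ ∑ i, |s - 2 * (((x i : ℤ) : ℝ) * a i)| := by
    have h1 := Finset.abs_sum_le_sum_abs (fun i => s - 2 * (((x i : ℤ) : ℝ) * a i)) Finset.univ
    rw [Finset.sum_sub_distrib, ← Finset.mul_sum, ← hs] at h1
    simp only [Finset.sum_const, Finset.card_univ, Fintype.card_fin, nsmul_eq_mul] at h1
    refine le_trans ?_ h1
    rw [show (n : ℝ) * s - 2 * s = (n - 2) * s by ring, abs_mul]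
    exact mul_le_mul_of_nonneg_right (le_abs_self _) (abs_nonneg _)
  simp only [hflip]
  rw [← Finset.sum_div, Finset.sum_sub_distrib, sq]
  refine mul_le_mul_of_nonneg_left ?_ (abs_nonneg _)
  simp only [Finset.sum_const, Finset.card_univ, Fintype.card_fin, nsmul_eq_mul]
  linarith

/-- For the even function `f = |∑ x_i a_i|`, the gap 2 and the energy bound give `2 (E f² - (E f)²)
≤ E f²`, that is, `E f² ≤ 2 (E f)²`. -/
theorem sqrt_sum_sq_le_expect {n : ℕ} (a : Fin n → ℝ) :
    √(∑ i, a i ^ 2) ≤ √2 * 𝔼 x : Fin n → ℤˣ, |∑ i, ((x i : ℤ) : ℝ) * a i| := by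
  have h1 := (expect_sq_le_cubeEnergy
    (fun x : Fin n → ℤˣ => |∑ i, ((x i : ℤ) : ℝ) * a i|)).2 (fun x => by simp)
  have h2 := cubeEnergy_abs_sum_le a
  have h3 : 𝔼 x : Fin n → ℤˣ, |∑ i, ((x i : ℤ) : ℝ) * a i| ^ 2 = ∑ i, a i ^ 2 := by
    simpa using expect_sq_add_sum n (0 : ℝ) a
  have h4 : 0 ≤ 𝔼 x : Fin n → ℤˣ, |∑ i, ((x i : ℤ) : ℝ) * a i| :=
    Finset.expect_nonneg fun _ _ => abs_nonneg _
  rw [h3] at h1 h2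
  refine Real.sqrt_le_iff.2 ⟨by positivity, ?_⟩
  rw [mul_pow, Real.sq_sqrt zero_le_two]
  linarith

/-! ### Contraction -/

/-- Contraction for one sign: the sign in front of `φ` is replaced by symmetric noise `ψ` that
dominates the increments of `φ` on average. -/
theorem exists_selection_sign_le {T N : Type*} [Fintype N] [Nonempty N] [InvolutiveNeg N]
    (φ A : T → ℝ) (ψ : N → T → ℝ) (hodd : ∀ η t, ψ (-η) t = -ψ η t)
    (hlip : ∀ t t', |φ t - φ t'| ≤ 𝔼 η, |ψ η t - ψ η t'|) (g : ℤˣ → T) :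
    ∃ t : N → T, 𝔼 e, (A (g e) + ((e : ℤ) : ℝ) * φ (g e)) ≤ 𝔼 η, (A (t η) + ψ η (t η)) := by
  -- For each noise value, take the better of the two points `g 1` and `g (-1)`.
  have hex : ∀ η, ∃ t, A (g 1) + ψ η (g 1) ≤ A t + ψ η t ∧
      A (g (-1)) + ψ η (g (-1)) ≤ A t + ψ η t := by
    intro η
    rcases le_total (A (g 1) + ψ η (g 1)) (A (g (-1)) + ψ η (g (-1))) with h | h
    · exact ⟨g (-1), h, le_rfl⟩
    · exact ⟨g 1, le_rfl, h⟩
  choose t ht1 ht2 using hex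
  refine ⟨t, ?_⟩
  have hsym : 𝔼 η, (A (t η) + ψ η (t η)) =
      𝔼 η, ((A (t η) + ψ η (t η)) + (A (t (-η)) + ψ (-η) (t (-η)))) / 2 := by
    have h := expect_neg (fun η => A (t η) + ψ η (t η))
    rw [← Finset.expect_div,
      Finset.expect_add_distrib _ (fun η => A (t η) + ψ η (t η)), h]
    ring
  -- Under `η` and `-η` the two points can be assigned in either order; the better order produces
  -- the absolute value.
  have hpt : ∀ η, (A (g 1) + A (g (-1)) + |ψ η (g 1) - ψ η (g (-1))|) / 2 ≤
      ((A (t η) + ψ η (t η)) + (A (t (-η)) + ψ (-η) (t (-η)))) / 2 := by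
    intro η
    have h1 := ht1 η
    have h2 := ht2 η
    have h3 := ht1 (-η)
    have h4 := ht2 (-η)
    rw [hodd η (g 1)] at h3
    rw [hodd η (g (-1))] at h4
    rcases abs_cases (ψ η (g 1) - ψ η (g (-1))) with ⟨h, _⟩ | ⟨h, _⟩ <;> rw [h] <;> linarith
  rw [hsym]
  refine le_trans ?_ (expect_mono hpt)
  rw [← Finset.expect_div, Finset.expect_add_distrib _ (fun _ => A (g 1) + A (g (-1))),
    Fintype.expect_const, expect_sign]
  have := (le_abs_self _).trans (hlip (g 1) (g (-1)))
  simp only [Units.val_one, Units.val_neg, Int.cast_one, Int.cast_neg]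
  linarith

theorem exists_selection_contraction {T N : Type*} [Fintype N] [Nonempty N] [InvolutiveNeg N]
    {m : ℕ} (φ : Fin m → T → ℝ) (ψ : Fin m → N → T → ℝ)
    (hodd : ∀ i η t, ψ i (-η) t = -ψ i η t)
    (hlip : ∀ i t t', |φ i t - φ i t'| ≤ 𝔼 η, |ψ i η t - ψ i η t'|)
    (a : T → ℝ) (g : (Fin m → ℤˣ) → T) :
    ∃ g' : (Fin m → N) → T, 𝔼 ε, (a (g ε) + ∑ i, ((ε i : ℤ) : ℝ) * φ i (g ε)) ≤
      𝔼 η, (a (g' η) + ∑ i, ψ i (η i) (g' η)) := by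
  induction m generalizing a with
  | zero =>
    refine ⟨fun _ => g default, le_of_eq ?_⟩
    simp only [Finset.univ_eq_empty, Finset.sum_empty, add_zero, Fintype.expect_const]
    exact (Finset.expect_congr rfl fun ε _ => by rw [Subsingleton.elim ε default]).trans
      (Fintype.expect_const _)
  | succ m ih =>
    -- The first sign is traded with the others frozen; its noise then joins the offset `a` for the
    -- induction hypothesis.
    choose t ht using fun y : Fin m → ℤˣ => exists_selection_sign_le (φ 0)
      (fun s => a s + ∑ i, ((y i : ℤ) : ℝ) * φ i.succ s) (ψ 0) (hodd 0) (hlip 0)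
      (fun e => g (Fin.cons e y))
    choose g' hg' using fun η : N => ih (fun i => φ i.succ) (fun i => ψ i.succ)
      (fun i => hodd i.succ) (fun i => hlip i.succ) (fun s => a s + ψ 0 η s) (fun y => t y η)
    refine ⟨fun x => g' (x 0) (Fin.tail x), ?_⟩
    rw [expect_cons, expect_cons, Finset.expect_comm]
    simp only [Fin.sum_univ_succ, Fin.cons_zero, Fin.cons_succ, Fin.tail_cons]
    calc _ = 𝔼 y : Fin m → ℤˣ, 𝔼 e : ℤˣ, ((a (g (Fin.cons e y)) +
          ∑ i, ((y i : ℤ) : ℝ) * φ i.succ (g (Fin.cons e y))) +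
            ((e : ℤ) : ℝ) * φ 0 (g (Fin.cons e y))) :=
          Finset.expect_congr rfl fun y _ => Finset.expect_congr rfl fun e _ => by ring
      _ ≤ 𝔼 y : Fin m → ℤˣ, 𝔼 η, ((a (t y η) + ∑ i, ((y i : ℤ) : ℝ) * φ i.succ (t y η)) +
            ψ 0 η (t y η)) := expect_mono ht
      _ = 𝔼 η, 𝔼 y : Fin m → ℤˣ, ((a (t y η) + ψ 0 η (t y η)) +
            ∑ i, ((y i : ℤ) : ℝ) * φ i.succ (t y η)) := by
          rw [Finset.expect_comm]
          exact Finset.expect_congr rfl fun y _ => Finset.expect_congr rfl fun e _ => by ring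
      _ ≤ _ := expect_mono hg'
      _ = _ := Finset.expect_congr rfl fun y _ => Finset.expect_congr rfl fun e _ => by ring

/-- Scalar contraction. -/
theorem exists_selection_lipschitz {T : Type*} {m : ℕ} (φ p : Fin m → T → ℝ)
    (hlip : ∀ i t t', |φ i t - φ i t'| ≤ |p i t - p i t'|) (g : (Fin m → ℤˣ) → T) :
    ∃ g' : (Fin m → ℤˣ) → T, 𝔼 ε : Fin m → ℤˣ, ∑ i, ((ε i : ℤ) : ℝ) * φ i (g ε) ≤
      𝔼 ε : Fin m → ℤˣ, ∑ i, ((ε i : ℤ) : ℝ) * p i (g' ε) := by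
  have h := exists_selection_contraction φ (fun i (e : ℤˣ) t => ((e : ℤ) : ℝ) * p i t)
    (fun i e t => by simp) (fun i t t' => by
      refine (hlip i t t').trans (le_of_eq ?_)
      rw [expect_sign, abs_sub_comm (((-1 : ℤˣ) : ℤ) * p i t : ℝ)]
      simp [add_comm, ← sub_eq_add_neg]) (fun _ => 0) g
  simpa using h

/-- Contraction of a vector-valued class by a function that is Lipschitz for the Euclidean
norm. -/
theorem exists_selection_lipschitz_vector {T : Type*} {m n : ℕ} (φ : Fin m → T → ℝ)
    (v : Fin m → T → Fin n → ℝ) {c : ℝ} (hc : 0 ≤ c)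
    (hlip : ∀ i t t', |φ i t - φ i t'| ≤ c * √(∑ k, (v i t k - v i t' k) ^ 2))
    (g : (Fin m → ℤˣ) → T) :
    ∃ g' : (Fin m → Fin n → ℤˣ) → T, 𝔼 ε : Fin m → ℤˣ, ∑ i, ((ε i : ℤ) : ℝ) * φ i (g ε) ≤
      √2 * c * ∑ k, 𝔼 η : Fin m → Fin n → ℤˣ, ∑ i, ((η i k : ℤ) : ℝ) * v i (g' η) k := by
  obtain ⟨g', h⟩ := exists_selection_contraction φ
    (fun i (η : Fin n → ℤˣ) t => √2 * c * ∑ k, ((η k : ℤ) : ℝ) * v i t k)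
    (fun i e t => by simp) (fun i t t' => by
      refine (hlip i t t').trans ?_
      have h := mul_le_mul_of_nonneg_left (sqrt_sum_sq_le_expect fun k => v i t k - v i t' k) hc
      refine h.trans (le_of_eq ?_)
      rw [← mul_assoc, Finset.mul_expect]
      refine Finset.expect_congr rfl fun η _ => ?_
      rw [← mul_sub, abs_mul, abs_of_nonneg (by positivity : 0 ≤ √2 * c),
        ← Finset.sum_sub_distrib, mul_comm c]
      simp only [mul_sub]) (fun _ => 0) g
  refine ⟨g', ?_⟩
  simp only [zero_add] at h
  refine h.trans (le_of_eq ?_)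
  rw [← Finset.expect_sum_comm, Finset.mul_expect]
  refine Finset.expect_congr rfl fun η _ => ?_
  rw [← Finset.mul_sum, Finset.sum_comm]

/-- A bound for every selection that depends on one column of signs holds for selections that
depend on all columns. -/
theorem expect_column_le {m n : ℕ} (k : Fin n) (f : (Fin m → Fin n → ℤˣ) → Fin m → ℝ)
    (F : Set (Fin m → ℝ)) (hf : ∀ η, f η ∈ F) {C : ℝ}
    (hF : ∀ g : (Fin m → ℤˣ) → Fin m → ℝ, (∀ ε, g ε ∈ F) →
      𝔼 ε : Fin m → ℤˣ, ∑ i, ((ε i : ℤ) : ℝ) * g ε i ≤ C) :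
    𝔼 η : Fin m → Fin n → ℤˣ, ∑ i, ((η i k : ℤ) : ℝ) * f η i ≤ C := by
  -- Column `k` is separated from the other columns `z`; for each fixed `z` the selection depends on
  -- column `k` alone.
  rw [expect_of_equiv_prod ((Equiv.piComm fun _ _ => ℤˣ).trans
    (Equiv.funSplitAt k (Fin m → ℤˣ))), Finset.expect_comm]
  refine Finset.expect_le Finset.univ_nonempty fun z _ => ?_
  have h := hF (fun ε => f (((Equiv.piComm fun _ _ => ℤˣ).trans
    (Equiv.funSplitAt k (Fin m → ℤˣ))).symm (ε, z))) fun ε => hf _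
  refine le_trans (le_of_eq ?_) h
  refine Finset.expect_congr rfl fun ε _ => Finset.sum_congr rfl fun i _ => ?_
  congr 3
  simp [Equiv.funSplitAt, Equiv.piSplitAt, Equiv.piComm, Function.swap]

theorem expect_abs_selection_le {T : Type*} {m : ℕ} (p : Fin m → T → ℝ) {C : ℝ}
    (t0 : T) (ht0 : ∀ i, p i t0 = 0)
    (hC : ∀ g : (Fin m → ℤˣ) → T, 𝔼 ε : Fin m → ℤˣ, ∑ i, ((ε i : ℤ) : ℝ) * p i (g ε) ≤ C)
    (g : (Fin m → ℤˣ) → T) :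
    𝔼 ε : Fin m → ℤˣ, |(∑ i, ((ε i : ℤ) : ℝ) * |p i (g ε)|)| ≤ 2 * C := by
  classical
  have hpos : ∀ g : (Fin m → ℤˣ) → T,
      𝔼 ε : Fin m → ℤˣ, max (∑ i, ((ε i : ℤ) : ℝ) * |p i (g ε)|) 0 ≤ C := by
    intro g
    obtain ⟨g', h⟩ := exists_selection_lipschitz (fun i t => |p i t|) p
      (fun i t t' => abs_abs_sub_abs_le_abs_sub _ _)
      -- Switching to the zero `t0` when the sum is negative realizes the positive part as a
      -- selection.
      (fun ε => if 0 ≤ ∑ i, ((ε i : ℤ) : ℝ) * |p i (g ε)| then g ε else t0)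
    refine le_trans (le_of_eq ?_) (h.trans (hC g'))
    refine Finset.expect_congr rfl fun ε _ => ?_
    split_ifs with h0
    · rw [max_eq_left h0]
    · rw [max_eq_right (not_le.1 h0).le]
      simp [ht0]
  have h1 := hpos g
  have h2 := hpos fun ε => g (-ε)
  rw [← expect_neg] at h2
  simp only [neg_neg, Pi.neg_apply, Units.val_neg, Int.cast_neg, neg_mul,
    Finset.sum_neg_distrib] at h2
  calc _ = 𝔼 ε : Fin m → ℤˣ, (max (∑ i, ((ε i : ℤ) : ℝ) * |p i (g ε)|) 0 +
        max (-∑ i, ((ε i : ℤ) : ℝ) * |p i (g ε)|) 0) := by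
        refine Finset.expect_congr rfl fun ε _ => ?_
        rw [max_zero_add_max_neg_zero_eq_abs_self]
    _ ≤ 2 * C := by
        rw [Finset.expect_add_distrib]
        linarith

/-! ### The spectral norm -/

theorem dotProduct_self_eq_norm_sq {n : ℕ} (v : Fin n → ℝ) :
    v ⬝ᵥ v = ‖(WithLp.toLp 2 v : EuclideanSpace ℝ (Fin n))‖ ^ 2 := by
  rw [EuclideanSpace.real_norm_sq_eq]
  simp [dotProduct, sq]

theorem zero_le_dotProduct_self {n : ℕ} (v : Fin n → ℝ) : 0 ≤ v ⬝ᵥ v := by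
  rw [dotProduct_self_eq_norm_sq]
  positivity

open scoped Matrix.Norms.L2Operator in
theorem mulVec_dotProduct_self_le {m n : ℕ} (A : Matrix (Fin m) (Fin n) ℝ) (x : Fin n → ℝ) :
    (A *ᵥ x) ⬝ᵥ (A *ᵥ x) ≤ matrixSpectralNorm A ^ 2 * (x ⬝ᵥ x) := by
  rw [dotProduct_self_eq_norm_sq, dotProduct_self_eq_norm_sq, ← mul_pow]
  exact pow_le_pow_left₀ (norm_nonneg _) (Matrix.l2_opNorm_mulVec A (WithLp.toLp 2 x)) 2

open scoped Matrix.Norms.L2Operator in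
theorem matrixSpectralNorm_transpose {m n : ℕ} (A : Matrix (Fin m) (Fin n) ℝ) :
    matrixSpectralNorm Aᵀ = matrixSpectralNorm A := by
  have h := Matrix.l2_opNorm_conjTranspose A
  rwa [Matrix.conjTranspose_eq_transpose_of_trivial] at h

theorem vecMul_dotProduct_self_le {m n : ℕ} (A : Matrix (Fin m) (Fin n) ℝ) (x : Fin m → ℝ) :
    (x ᵥ* A) ⬝ᵥ (x ᵥ* A) ≤ matrixSpectralNorm A ^ 2 * (x ⬝ᵥ x) := by
  rw [← matrixSpectralNorm_transpose, ← Matrix.mulVec_transpose]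
  exact mulVec_dotProduct_self_le _ _

theorem row_dotProduct_self_le {m n : ℕ} (A : Matrix (Fin m) (Fin n) ℝ) (i : Fin m) :
    A i ⬝ᵥ A i ≤ matrixSpectralNorm A ^ 2 := by
  have h := vecMul_dotProduct_self_le A (Pi.single i 1)
  simpa [Matrix.row] using h

/-- The squared Frobenius norm is summed over rows or over columns, whichever are fewer; each has
length at most the spectral norm. -/
theorem sum_row_dotProduct_self_le {m n : ℕ} (A : Matrix (Fin m) (Fin n) ℝ) :
    ∑ i, A i ⬝ᵥ A i ≤ (min m n : ℕ) * matrixSpectralNorm A ^ 2 := by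
  have h1 : ∀ {m n : ℕ} (A : Matrix (Fin m) (Fin n) ℝ),
      ∑ i, A i ⬝ᵥ A i ≤ m * matrixSpectralNorm A ^ 2 := fun {m n} A =>
    (Finset.sum_le_sum fun i _ => row_dotProduct_self_le A i).trans (by simp)
  rcases min_cases m n with ⟨h, _⟩ | ⟨h, _⟩ <;> rw [h]
  · exact h1 A
  · refine le_trans (le_of_eq ?_) ((h1 Aᵀ).trans (by rw [matrixSpectralNorm_transpose]))
    simp only [dotProduct, Matrix.transpose_apply]
    exact Finset.sum_comm

open scoped Matrix.Norms.L2Operator in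
theorem matrixSpectralNorm_nonneg {m n : ℕ} (A : Matrix (Fin m) (Fin n) ℝ) :
    0 ≤ matrixSpectralNorm A := norm_nonneg A

open scoped Matrix.Norms.L2Operator in
theorem pos_of_matrixSpectralNorm_eq_one {m n : ℕ} {A : Matrix (Fin m) (Fin n) ℝ}
    (hA : matrixSpectralNorm A = 1) : 0 < m ∧ 0 < n := by
  have h : ∀ _ : Subsingleton (Matrix (Fin m) (Fin n) ℝ), False := fun h => by
    rw [Subsingleton.elim A 0, matrixSpectralNorm, norm_zero] at hA
    exact zero_ne_one hA
  refine ⟨Nat.pos_of_ne_zero ?_, Nat.pos_of_ne_zero ?_⟩ <;> rintro rfl <;> exact h inferInstance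

/-! ### GroupSort as a combination of a linear map and absolute values -/

/-- The index with which a coordinate is compared by GroupSort. -/
def pairIndex {m : ℕ} (hm : Even m) (i : Fin m) : Fin m :=
  if h : (i : ℕ) % 2 = 1 then ⟨(i : ℕ) - 1, by omega⟩
  else ⟨(i : ℕ) + 1, by have := i.isLt; obtain ⟨k, rfl⟩ := hm; omega⟩

theorem pairIndex_involutive {m : ℕ} (hm : Even m) : Function.Involutive (pairIndex hm) := by
  intro i
  ext
  unfold pairIndex
  split_ifs with h1 h2 h2 <;> simp only at h2 ⊢ <;> omega

theorem sum_pairIndex {m : ℕ} (hm : Even m) (f : Fin m → ℝ) :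
    ∑ i, f (pairIndex hm i) = ∑ i, f i :=
  Equiv.sum_comp (pairIndex_involutive hm).toPerm f

/-- The sign of the absolute value in a coordinate of GroupSort. -/
def pairSign {m : ℕ} (i : Fin m) : ℝ := if (i : ℕ) % 2 = 1 then -1 else 1

theorem abs_pairSign {m : ℕ} (i : Fin m) : |pairSign i| = 1 := by
  unfold pairSign
  split_ifs <;> simp

theorem groupSort_eq {m : ℕ} (hm : Even m) (u : Fin m → ℝ) (i : Fin m) :
    groupSort u i =
      (u i + u (pairIndex hm i)) / 2 + pairSign i * (|u i - u (pairIndex hm i)| / 2) := by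
  unfold groupSort pairIndex pairSign
  split_ifs with h1 h2
  · rcases le_total (u i) (u ⟨(i : ℕ) - 1, by omega⟩) with h | h
    · rw [min_eq_right h, abs_of_nonpos (sub_nonpos.2 h)]
      ring
    · rw [min_eq_left h, abs_of_nonneg (sub_nonneg.2 h)]
      ring
  · rcases le_total (u i) (u ⟨(i : ℕ) + 1, h2⟩) with h | h
    · rw [max_eq_right h, abs_of_nonpos (sub_nonpos.2 h)]
      ring
    · rw [max_eq_left h, abs_of_nonneg (sub_nonneg.2 h)]
      ring
  · have := i.isLt
    obtain ⟨k, rfl⟩ := hm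
    omega

/-- The vector `u` with the same pairing against `x` as `v` has against the averages over the
pairs of `x`. -/
noncomputable def pairAvg {m : ℕ} (hm : Even m) (v : Fin m → ℝ) (i : Fin m) : ℝ :=
  (v i + v (pairIndex hm i)) / 2

theorem pairAvg_dotProduct_self_le {m : ℕ} (hm : Even m) (v : Fin m → ℝ) :
    pairAvg hm v ⬝ᵥ pairAvg hm v ≤ v ⬝ᵥ v := by
  have h : ∀ i, pairAvg hm v i * pairAvg hm v i ≤
      (v i * v i + v (pairIndex hm i) * v (pairIndex hm i)) / 2 := fun i => by
    unfold pairAvg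
    nlinarith [sq_nonneg (v i - v (pairIndex hm i))]
  refine (Finset.sum_le_sum fun i _ => h i).trans (le_of_eq ?_)
  rw [← Finset.sum_div, Finset.sum_add_distrib, sum_pairIndex hm fun i => v i * v i]
  simp [dotProduct]

theorem dotProduct_groupSort {m : ℕ} (hm : Even m) (v u : Fin m → ℝ) :
    v ⬝ᵥ groupSort u = pairAvg hm v ⬝ᵥ u +
      ∑ j, v j * pairSign j / 2 * |u j - u (pairIndex hm j)| := by
  have h : ∑ j, v j * u (pairIndex hm j) = ∑ j, v (pairIndex hm j) * u j := by
    rw [← sum_pairIndex hm]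
    simp only [pairIndex_involutive hm _]
  have h1 : pairAvg hm v ⬝ᵥ u = (∑ j, v j * u j + ∑ j, v j * u (pairIndex hm j)) / 2 := by
    rw [h, ← Finset.sum_add_distrib, Finset.sum_div]
    exact Finset.sum_congr rfl fun j _ => by unfold pairAvg; ring
  rw [h1, ← Finset.sum_add_distrib, Finset.sum_div, ← Finset.sum_add_distrib]
  exact Finset.sum_congr rfl fun j _ => by rw [groupSort_eq hm]; ring

/-! ### Rademacher bounds for layers -/

/-- `C` bounds the average of `∑ i, ε i * ⟪v, h i⟫` whatever vector `v` in the unit ball and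
tuple of feature vectors `h ∈ H` are selected depending on `ε`. -/
def SelectionBound {m n : ℕ} (H : Set (Fin m → Fin n → ℝ)) (C : ℝ) : Prop :=
  ∀ (h : (Fin m → ℤˣ) → Fin m → Fin n → ℝ) (v : (Fin m → ℤˣ) → Fin n → ℝ),
    (∀ ε, h ε ∈ H) → (∀ ε, v ε ⬝ᵥ v ε ≤ 1) →
      𝔼 ε : Fin m → ℤˣ, ∑ i, ((ε i : ℤ) : ℝ) * (v ε ⬝ᵥ h ε i) ≤ C

/-- The analogue of `SelectionBound` for `|∑ i, ε i * |⟪v, h i⟫||`. -/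
def AbsSelectionBound {m n : ℕ} (H : Set (Fin m → Fin n → ℝ)) (D : ℝ) : Prop :=
  ∀ (h : (Fin m → ℤˣ) → Fin m → Fin n → ℝ) (v : (Fin m → ℤˣ) → Fin n → ℝ),
    (∀ ε, h ε ∈ H) → (∀ ε, v ε ⬝ᵥ v ε ≤ 1) →
      𝔼 ε : Fin m → ℤˣ, |(∑ i, ((ε i : ℤ) : ℝ) * |v ε ⬝ᵥ h ε i|)| ≤ D

theorem SelectionBound.abs {m n : ℕ} {H : Set (Fin m → Fin n → ℝ)} {C : ℝ}
    (hC : SelectionBound H C) : AbsSelectionBound H (2 * C) := by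
  intro h v hh hv
  let T := {t : (Fin n → ℝ) × (Fin m → Fin n → ℝ) // t.1 ⬝ᵥ t.1 ≤ 1 ∧ t.2 ∈ H}
  exact expect_abs_selection_le (T := T) (fun i t => t.1.1 ⬝ᵥ t.1.2 i)
    ⟨(0, h 1), by simp, hh 1⟩ (fun i => by simp)
    (fun g => hC (fun ε => (g ε).1.2) (fun ε => (g ε).1.1) (fun ε => (g ε).2.2)
      fun ε => (g ε).2.1)
    (fun ε => ⟨(v ε, h ε), hv ε, hh ε⟩)

/-- Absolute values are positively homogeneous, so the lengths of the `D j` come out; the worst unit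
direction bounds all terms, and Cauchy–Schwarz handles the weights. -/
theorem exists_sum_abs_le {m n k : ℕ} [Nonempty (Fin k)] (c : Fin k → ℝ) (D : Fin k → Fin n → ℝ)
    (s : Fin m → ℝ) (h : Fin m → Fin n → ℝ) :
    ∃ p : Fin n → ℝ, p ⬝ᵥ p ≤ 1 ∧ ∑ i, s i * ∑ j, c j * |D j ⬝ᵥ h i| ≤
      √(∑ j, c j ^ 2) * √(∑ j, D j ⬝ᵥ D j) * |(∑ i, s i * |p ⬝ᵥ h i|)| := by
  let r : Fin k → ℝ := fun j => √(D j ⬝ᵥ D j)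
  -- A zero row gives `p j = 0`, since `0⁻¹ = 0`; hence only `p ⬝ᵥ p ≤ 1` is claimed.
  let p : Fin k → Fin n → ℝ := fun j => (r j)⁻¹ • D j
  have hr : ∀ j, r j ^ 2 = D j ⬝ᵥ D j := fun j => Real.sq_sqrt (zero_le_dotProduct_self _)
  have hr0 : ∀ j, 0 ≤ r j := fun j => Real.sqrt_nonneg _
  have hD : ∀ j, D j = r j • p j := by
    intro j
    rcases eq_or_ne (r j) 0 with h0 | h0
    · have h1 := hr j
      rw [h0, dotProduct_self_eq_norm_sq] at h1
      have h2 : D j = 0 := by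
        have : ‖(WithLp.toLp 2 (D j) : EuclideanSpace ℝ (Fin n))‖ = 0 := by nlinarith
        simpa using this
      rw [h0, h2, zero_smul]
    · simp only [p, smul_smul, mul_inv_cancel₀ h0, one_smul]
  obtain ⟨J, hJ⟩ := Finite.exists_max fun j => |(∑ i, s i * |p j ⬝ᵥ h i|)|
  refine ⟨p J, ?_, ?_⟩
  · simp only [p, smul_dotProduct, dotProduct_smul, smul_eq_mul, ← hr]
    rcases eq_or_ne (r J) 0 with h0 | h0
    · simp [h0]
    · field_simp
      exact le_rfl
  · set K := |(∑ i, s i * |p J ⬝ᵥ h i|)| with hK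
    calc ∑ i, s i * ∑ j, c j * |D j ⬝ᵥ h i|
        = ∑ j, c j * r j * ∑ i, s i * |p j ⬝ᵥ h i| := by
          simp only [Finset.mul_sum]
          rw [Finset.sum_comm]
          refine Finset.sum_congr rfl fun j _ => Finset.sum_congr rfl fun i _ => ?_
          rw [hD j, smul_dotProduct, smul_eq_mul, abs_mul, abs_of_nonneg (hr0 j)]
          ring
      _ ≤ ∑ j, |c j| * r j * K := by
          refine Finset.sum_le_sum fun j _ => (le_abs_self _).trans ?_
          rw [abs_mul, abs_mul, abs_of_nonneg (hr0 j)]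
          exact mul_le_mul_of_nonneg_left (hJ j) (mul_nonneg (abs_nonneg _) (hr0 j))
      _ ≤ _ := by
          rw [← Finset.sum_mul]
          refine mul_le_mul_of_nonneg_right ?_ (abs_nonneg _)
          have h1 := Real.sum_mul_le_sqrt_mul_sqrt Finset.univ (fun j => |c j|) r
          simpa only [sq_abs, hr] using h1

theorem sum_row_sub_pairIndex_le {m n : ℕ} (hm : Even m) (A : Matrix (Fin m) (Fin n) ℝ) :
    ∑ j, (A j - A (pairIndex hm j)) ⬝ᵥ (A j - A (pairIndex hm j)) ≤ 4 * ∑ j, A j ⬝ᵥ A j := by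
  have h : ∀ a b : Fin n → ℝ, (a - b) ⬝ᵥ (a - b) ≤ 2 * (a ⬝ᵥ a) + 2 * (b ⬝ᵥ b) := fun a b => by
    have := zero_le_dotProduct_self (a + b)
    simp only [add_dotProduct, dotProduct_add, sub_dotProduct, dotProduct_sub] at this ⊢
    linarith
  refine (Finset.sum_le_sum fun j _ => h _ _).trans (le_of_eq ?_)
  rw [Finset.sum_add_distrib, ← Finset.mul_sum, ← Finset.mul_sum,
    sum_pairIndex hm fun j => A j ⬝ᵥ A j]
  ring

/-- The linear part keeps its vector in the unit ball. For the rest, the weights have norm at most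
`1/2` and the row differences total at most `4 * min k n`, so the factor is `√(min k n)`. -/
theorem SelectionBound.layer {m n k : ℕ} (hk : Even k) (hk0 : 0 < k)
    {H : Set (Fin m → Fin n → ℝ)} {C D : ℝ} (hC : SelectionBound H C)
    (hD : AbsSelectionBound H D) :
    SelectionBound {h' : Fin m → Fin k → ℝ | ∃ W : Matrix (Fin k) (Fin n) ℝ,
      matrixSpectralNorm W ≤ 1 ∧ ∃ h ∈ H, ∀ i, h' i = groupSort (W *ᵥ h i)}
      (C + √(min k n : ℕ) * D) := by
  intro h' v hh' hv
  choose W hW h hh e using hh'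
  have : Nonempty (Fin k) := ⟨⟨0, hk0⟩⟩
  choose p hp hle using fun ε : Fin m → ℤˣ => exists_sum_abs_le
    (fun j => v ε j * pairSign j / 2) (fun j => W ε j - W ε (pairIndex hk j))
    (fun i => ((ε i : ℤ) : ℝ)) (h ε)
  have hW1 : ∀ ε, matrixSpectralNorm (W ε) ^ 2 ≤ 1 := fun ε =>
    pow_le_one₀ (matrixSpectralNorm_nonneg _) (hW ε)
  have hpt : ∀ ε : Fin m → ℤˣ, ∑ i, ((ε i : ℤ) : ℝ) * (v ε ⬝ᵥ h' ε i) ≤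
      ∑ i, ((ε i : ℤ) : ℝ) * ((pairAvg hk (v ε) ᵥ* W ε) ⬝ᵥ h ε i) +
        √(min k n : ℕ) * |(∑ i, ((ε i : ℤ) : ℝ) * |p ε ⬝ᵥ h ε i|)| := by
    intro ε
    have hsplit : ∀ i, v ε ⬝ᵥ h' ε i = (pairAvg hk (v ε) ᵥ* W ε) ⬝ᵥ h ε i +
        ∑ j, v ε j * pairSign j / 2 * |(W ε j - W ε (pairIndex hk j)) ⬝ᵥ h ε i| := by
      intro i
      rw [e, dotProduct_groupSort hk, Matrix.dotProduct_mulVec]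
      simp only [sub_dotProduct]
      rfl
    simp only [hsplit, mul_add, Finset.sum_add_distrib]
    refine add_le_add le_rfl ((hle ε).trans ?_)
    refine mul_le_mul_of_nonneg_right ?_ (abs_nonneg _)
    have h1 : ∑ j, (v ε j * pairSign j / 2) ^ 2 ≤ (1 / 2) ^ 2 := by
      have h2 : ∀ j, (v ε j * pairSign j / 2) ^ 2 = v ε j * v ε j / 4 := fun j => by
        rw [div_pow, mul_pow, ← sq_abs (pairSign j), abs_pairSign]
        ring
      simp only [h2]
      rw [← Finset.sum_div]
      have h3 : ∑ j, v ε j * v ε j ≤ 1 := hv ε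
      linarith
    have h4 : ∑ j, (W ε j - W ε (pairIndex hk j)) ⬝ᵥ (W ε j - W ε (pairIndex hk j)) ≤
        4 * (min k n : ℕ) := by
      refine (sum_row_sub_pairIndex_le hk _).trans (mul_le_mul_of_nonneg_left ?_ (by norm_num))
      exact (sum_row_dotProduct_self_le _).trans
        (mul_le_of_le_one_right (Nat.cast_nonneg _) (hW1 ε))
    calc _ ≤ √((1 / 2) ^ 2) * √(4 * (min k n : ℕ)) :=
          mul_le_mul (Real.sqrt_le_sqrt h1) (Real.sqrt_le_sqrt h4) (Real.sqrt_nonneg _)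
            (Real.sqrt_nonneg _)
      _ = √(min k n : ℕ) := by
          rw [← Real.sqrt_mul (by positivity)]
          congr 1
          ring
  refine (expect_mono hpt).trans ?_
  rw [Finset.expect_add_distrib, ← Finset.mul_expect]
  refine add_le_add (hC h _ hh fun ε => ?_)
    (mul_le_mul_of_nonneg_left (hD h p hh hp) (Real.sqrt_nonneg _))
  refine (vecMul_dotProduct_self_le _ _).trans ?_
  exact mul_le_one₀ (hW1 ε) (zero_le_dotProduct_self _)
    ((pairAvg_dotProduct_self_le hk _).trans (hv ε))

theorem norm_toLp_le_one {n : ℕ} {v : Fin n → ℝ} (hv : v ⬝ᵥ v ≤ 1) :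
    ‖(WithLp.toLp 2 v : EuclideanSpace ℝ (Fin n))‖ ≤ 1 := by
  rw [dotProduct_self_eq_norm_sq] at hv
  exact (sq_le_one_iff₀ (norm_nonneg _)).1 hv

theorem selectionBound_inputs {m n : ℕ} (x : Fin m → EuclideanSpace ℝ (Fin n)) {B : ℝ}
    (hB : 0 ≤ B) (hx : ∀ i, ‖x i‖ ≤ B) :
    SelectionBound {h : Fin m → Fin n → ℝ | ∀ i, h i = fun j => x i j} (B * √m) := by
  intro h v hh hv
  refine (expect_mono fun ε => ?_).trans (expect_norm_sum_le x hB hx)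
  have h1 := real_inner_le_norm (WithLp.toLp 2 (v ε)) (∑ i, ((ε i : ℤ) : ℝ) • x i)
  have h2 : inner ℝ (WithLp.toLp 2 (v ε)) (∑ i, ((ε i : ℤ) : ℝ) • x i) =
      ∑ i, ((ε i : ℤ) : ℝ) * (v ε ⬝ᵥ h ε i) := by
    rw [inner_sum]
    refine Finset.sum_congr rfl fun i _ => ?_
    rw [inner_smul_right, hh ε i]
    congr 1
    simp [PiLp.inner_apply, dotProduct, mul_comm]
  rw [h2] at h1
  exact h1.trans (mul_le_of_le_one_left (norm_nonneg _) (norm_toLp_le_one (hv ε)))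

/-- In dimension one `|v * x| = |v| * |x|`, so this is again a signed sum of fixed numbers and no
contraction factor 2 is lost. -/
theorem absSelectionBound_inputs {m n : ℕ} (hn : n = 1) (x : Fin m → EuclideanSpace ℝ (Fin n))
    {B : ℝ} (hB : 0 ≤ B) (hx : ∀ i, ‖x i‖ ≤ B) :
    AbsSelectionBound {h : Fin m → Fin n → ℝ | ∀ i, h i = fun j => x i j} (B * √m) := by
  subst hn
  intro h v hh hv
  refine (expect_mono fun ε => ?_).trans (expect_norm_sum_le (fun i => |x i 0|) hB fun i => ?_)
  · have h1 : ∀ i, |v ε ⬝ᵥ h ε i| = |v ε 0| * |x i 0| := fun i => by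
      rw [hh ε i]
      simp [dotProduct, abs_mul]
    have h2 : |v ε 0| ≤ 1 := by
      have h3 := hv ε
      simp only [dotProduct, Finset.univ_unique, Fin.default_eq_zero, Finset.sum_singleton] at h3
      exact abs_le_one_iff_mul_self_le_one.2 h3
    simp only [h1, smul_eq_mul, Real.norm_eq_abs]
    rw [show ∑ i, ((ε i : ℤ) : ℝ) * (|v ε 0| * |x i 0|) =
      |v ε 0| * ∑ i, ((ε i : ℤ) : ℝ) * |x i 0| by
        rw [Finset.mul_sum]
        exact Finset.sum_congr rfl fun i _ => by ring, abs_mul, abs_abs]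
    exact mul_le_of_le_one_left (abs_nonneg _) h2
  · have h4 := hx i
    rw [EuclideanSpace.norm_eq] at h4
    simpa [Real.sqrt_sq_eq_abs] using h4

theorem SelectionBound.mono {m n : ℕ} {H H' : Set (Fin m → Fin n → ℝ)} {C C' : ℝ}
    (hC : SelectionBound H C) (hH : H' ⊆ H) (h : C ≤ C') : SelectionBound H' C' :=
  fun f v hf hv => (hC f v (fun ε => hH (hf ε)) hv).trans h

/-- The tuples of outputs of the first `k` hidden layers at the inputs `x i`. -/
def hiddenOutputs (w : ℕ → ℕ) {m : ℕ} (x : Fin m → EuclideanSpace ℝ (Fin (w 0))) (k : ℕ) :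
    Set (Fin m → Fin (w k) → ℝ) :=
  {h | ∃ W : (i : ℕ) → Matrix (Fin (w (i + 1))) (Fin (w i)) ℝ,
    (∀ i < k, matrixSpectralNorm (W i) ≤ 1) ∧ ∀ i, h i = hidden w W k (fun j => x i j)}

theorem selectionBound_hiddenOutputs (w : ℕ → ℕ) {m : ℕ}
    (x : Fin m → EuclideanSpace ℝ (Fin (w 0))) {B : ℝ} (hB : 0 ≤ B) (hx : ∀ i, ‖x i‖ ≤ B)
    (k : ℕ) (hw : ∀ i, 1 ≤ i → i ≤ k → Even (w i)) (hpos : ∀ i ≤ k, 0 < w i) :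
    SelectionBound (hiddenOutputs w x k)
      (B * √m * (2 ^ k * ∏ i ∈ Finset.range k, ((min (w (i + 1)) (w i) : ℕ) : ℝ))) := by
  induction k with
  | zero =>
    refine (selectionBound_inputs x hB hx).mono ?_ (by simp)
    rintro h ⟨W, -, h1⟩
    exact h1
  | succ k ih =>
    have hC := ih (fun i h1 h2 => hw i h1 (by omega)) (fun i hi => hpos i (by omega))
    set C := B * √m * (2 ^ k * ∏ i ∈ Finset.range k, ((min (w (i + 1)) (w i) : ℕ) : ℝ)) with hCdef
    have hC0 : 0 ≤ C := by positivity
    have heven := hw (k + 1) (by omega) le_rfl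
    have hsub : hiddenOutputs w x (k + 1) ⊆ {h' : Fin m → Fin (w (k + 1)) → ℝ |
        ∃ W : Matrix (Fin (w (k + 1))) (Fin (w k)) ℝ, matrixSpectralNorm W ≤ 1 ∧
          ∃ h ∈ hiddenOutputs w x k, ∀ i, h' i = groupSort (W *ᵥ h i)} := by
      rintro h ⟨W, h1, h2⟩
      exact ⟨W k, h1 k (by omega), fun i => hidden w W k (fun j => x i j),
        ⟨W, fun i hi => h1 i (by omega), fun i => rfl⟩, h2⟩
    have hgoal : B * √m * (2 ^ (k + 1) *
        ∏ i ∈ Finset.range (k + 1), ((min (w (i + 1)) (w i) : ℕ) : ℝ)) =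
        2 * (min (w (k + 1)) (w k) : ℕ) * C := by
      rw [hCdef, Finset.prod_range_succ]
      ring
    rw [hgoal]
    have hp1 := hpos (k + 1) le_rfl
    have hp0 := hpos k (by omega)
    have htwo : 2 ≤ w (k + 1) := by
      obtain ⟨r, hr⟩ := heven
      omega
    -- Here `1 + 2√N ≤ 2N` would fail. Hidden widths are even, so this is the input layer, and `C +
    -- C = 2 * C` suffices.
    by_cases h1 : w k = 1
    · have hk : k = 0 := by
        by_contra hk
        obtain ⟨r, hr⟩ := hw k (by omega) (by omega)
        omega
      subst hk
      have hD : AbsSelectionBound (hiddenOutputs w x 0) C := by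
        intro h v hh hv
        have hCe : C = B * √m := by simp [hCdef]
        rw [hCe]
        refine absSelectionBound_inputs h1 x hB hx h v (fun ε => ?_) hv
        obtain ⟨W, -, h2⟩ := hh ε
        exact h2
      refine (hC.layer heven hp1 hD).mono hsub ?_
      rw [h1, min_eq_right (by omega : 1 ≤ w (0 + 1))]
      simp
      linarith
    · refine (hC.layer heven hp1 hC.abs).mono hsub ?_
      set N := min (w (k + 1)) (w k) with hN
      have hN2 : (2 : ℝ) ≤ N := by
        have : 2 ≤ N := le_min htwo (by omega)
        exact_mod_cast this
      have hs : 2 * √(N : ℝ) ≤ 2 * N - 1 := by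
        have := Real.sq_sqrt (Nat.cast_nonneg N : (0 : ℝ) ≤ N)
        refine le_of_sq_le_sq ?_ (by linarith)
        nlinarith
      nlinarith

/-! ### From selections to the Rademacher complexity -/

theorem empiricalRademacher_le {Z : Type*} {m : ℕ} (S : Fin m → Z) (G : Set (Z → ℝ)) {C : ℝ}
    (hC0 : 0 ≤ C)
    (hC : ∀ g : (Fin m → ℤˣ) → Z → ℝ, (∀ ε, g ε ∈ G) →
      𝔼 ε : Fin m → ℤˣ, ∑ i, ((ε i : ℤ) : ℝ) * g ε (S i) ≤ C) :
    empiricalRademacher S G ≤ C / m := by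
  unfold empiricalRademacher
  rcases G.eq_empty_or_nonempty with rfl | hG
  · simp
    positivity
  · refine le_of_forall_pos_le_add fun δ hδ => ?_
    -- Near-maximizers suffice, so the supremum need not be attained.
    have hex : ∀ ε : Fin m → ℤˣ, ∃ g ∈ G,
        sSup ((fun g : Z → ℝ => (1 / (m : ℝ)) * ∑ i, ((ε i : ℤ) : ℝ) * g (S i)) '' G) ≤
          (1 / (m : ℝ)) * ∑ i, ((ε i : ℤ) : ℝ) * g (S i) + δ := by
      intro ε
      obtain ⟨_, ⟨g, hg, rfl⟩, h⟩ := exists_lt_of_lt_csSup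
        (hG.image fun g : Z → ℝ => (1 / (m : ℝ)) * ∑ i, ((ε i : ℤ) : ℝ) * g (S i))
        (sub_lt_self _ hδ)
      exact ⟨g, hg, by linarith⟩
    choose g hg h using hex
    refine (expect_mono h).trans ?_
    rw [Finset.expect_add_distrib, Fintype.expect_const, ← Finset.mul_expect, one_div,
      div_eq_inv_mul]
    gcongr
    exact hC g hg

theorem expect_spectralDenseClass_le {d : ℕ} {w : ℕ → ℕ}
    (hw : ∀ i, 1 ≤ i → i ≤ d - 1 → Even (w i))
    {X : Set (EuclideanSpace ℝ (Fin (w 0)))} {B : ℝ} (hB : 0 ≤ B) (hX : ∀ x ∈ X, ‖x‖ ≤ B)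
    {m : ℕ} (x : Fin m → X) (f : (Fin m → ℤˣ) → X → ℝ)
    (hf : ∀ ε, f ε ∈ spectralDenseClass d w X) :
    𝔼 ε : Fin m → ℤˣ, ∑ i, ((ε i : ℤ) : ℝ) * f ε (x i) ≤
      B * √m * (2 ^ (d - 1) *
        ∏ i ∈ Finset.range (d - 1), ((min (w (i + 1)) (w i) : ℕ) : ℝ)) := by
  choose W V hW hV hfe using hf
  -- An empty matrix has norm 0, so norm 1 forces positive widths.
  have hpos : ∀ i ≤ d - 1, 0 < w i := by
    intro i hi
    rcases hi.lt_or_eq with h | rfl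
    · exact (pos_of_matrixSpectralNorm_eq_one (hW 1 i h)).2
    · exact (pos_of_matrixSpectralNorm_eq_one (hV 1)).2
  have h := selectionBound_hiddenOutputs w (fun i => (x i : EuclideanSpace ℝ (Fin (w 0)))) hB
    (fun i => hX _ (x i).2) (d - 1) hw hpos
    (fun ε i => hidden w (W ε) (d - 1) fun j => (x i : EuclideanSpace ℝ (Fin (w 0))) j)
    (fun ε => V ε 0) (fun ε => ⟨W ε, fun i hi => (hW ε i hi).le, fun i => rfl⟩)
    (fun ε => (row_dotProduct_self_le (V ε) 0).trans (by rw [hV, one_pow]))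
  refine le_trans (le_of_eq ?_) h
  simp only [hfe]
  rfl

theorem expect_lossClass_le {d : ℕ} {w : ℕ → ℕ}
    (hw : ∀ i, 1 ≤ i → i ≤ d - 1 → Even (w i)) {dy : ℕ}
    {X : Set (EuclideanSpace ℝ (Fin (w 0)))} {B : ℝ} (hB : 0 ≤ B) (hX : ∀ x ∈ X, ‖x‖ ≤ B)
    {Y : Set (EuclideanSpace ℝ (Fin dy))} {L : Y → Y → ℝ} {Lr : NNReal}
    (hL : ∀ y', LipschitzWith Lr (fun y => L y y')) {m : ℕ} (S : Fin m → X × Y)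
    (g : (Fin m → ℤˣ) → X × Y → ℝ) (hg : ∀ ε, g ε ∈ lossClass L (vectorClass d w X Y)) :
    𝔼 ε : Fin m → ℤˣ, ∑ i, ((ε i : ℤ) : ℝ) * g ε (S i) ≤
      √2 * Lr * (dy * (B * √m * (2 ^ (d - 1) *
        ∏ i ∈ Finset.range (d - 1), ((min (w (i + 1)) (w i) : ℕ) : ℝ)))) := by
  choose h hh hge using hg
  obtain ⟨g', hle⟩ := exists_selection_lipschitz_vector (T := vectorClass d w X Y)
    (fun i t => L (t.1 (S i).1) (S i).2)
    (fun i t k => (t.1 (S i).1 : EuclideanSpace ℝ (Fin dy)) k) Lr.coe_nonneg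
    (fun i t t' => by
      have h1 := (hL (S i).2).dist_le_mul (t.1 (S i).1) (t'.1 (S i).1)
      rw [Real.dist_eq, Subtype.dist_eq, EuclideanSpace.dist_eq] at h1
      simpa only [Real.dist_eq, sq_abs] using h1)
    (fun ε => ⟨h ε, hh ε⟩)
  simp only [hge]
  set C := B * √m * (2 ^ (d - 1) *
    ∏ i ∈ Finset.range (d - 1), ((min (w (i + 1)) (w i) : ℕ) : ℝ))
  refine hle.trans (mul_le_mul_of_nonneg_left ?_ (by positivity))
  refine (Finset.sum_le_card_nsmul _ _ C fun k _ => ?_).trans (by simp)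
  refine expect_column_le k _
    {u | ∃ f ∈ spectralDenseClass d w X, ∀ i, u i = f (S i).1}
    (fun η => ⟨_, (g' η).2 k, fun i => rfl⟩) fun u hu => ?_
  choose f hf hfu using hu
  simp only [hfu]
  exact expect_spectralDenseClass_le hw hB hX (fun i => (S i).1) f hf

end LCNN

theorem mainTheorem4 (d : ℕ) (hd : 1 ≤ d) (w : ℕ → ℕ)
    (hw : ∀ i, 1 ≤ i → i ≤ d - 1 → Even (w i))
    (dy : ℕ) (X : Set (EuclideanSpace ℝ (Fin (w 0)))) (B : ℝ) (hX : ∀ x ∈ X, ‖x‖ ≤ B)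
    (Y : Set (EuclideanSpace ℝ (Fin dy))) (L : Y → Y → ℝ)
    (hL_nonneg : ∀ y y', 0 ≤ L y y')
    (M : ℝ) (hM : 0 < M) (hL_bdd : ∀ y y', L y y' ≤ M)
    (Lr : NNReal) (hLr : 0 < Lr) (hL_lip : ∀ y', LipschitzWith Lr (fun y => L y y'))
    (m : ℕ) (hm : 0 < m) (S : Fin m → X × Y) :
    LCNN.empiricalRademacher S (LCNN.lossClass L (LCNN.vectorClass d w X Y)) ≤
      (Real.sqrt 2 * (dy : ℝ) * (Lr : ℝ) * B / Real.sqrt (m : ℝ)) * 2 ^ (d - 1) *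
        ∏ i ∈ Finset.range (d - 1), ((min (w (i + 1)) (w i) : ℕ) : ℝ) := by
  -- A sample point exists because `m` is positive.
  have hB : 0 ≤ B := (norm_nonneg _).trans (hX _ (S ⟨0, hm⟩).1.2)
  refine (LCNN.empiricalRademacher_le S _ (by positivity)
    (LCNN.expect_lossClass_le hw hB hX hL_lip S)).trans (le_of_eq ?_)
  have hm0 : (0 : ℝ) < √m := Real.sqrt_pos.2 (Nat.cast_pos.2 hm)
  have hmm : (m : ℝ) = √m * √m := (Real.mul_self_sqrt (Nat.cast_nonneg m)).symm
  rw [div_mul_eq_mul_div, div_mul_eq_mul_div, div_eq_div_iff (by positivity) hm0.ne']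
  nth_rewrite 3 [hmm]
  ring
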